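/- Let $n\ge 1$, let $\Omega\subset\mathbb R^n$ be a bounded open set, let $\epsilon\in(0,\infty]$ and $T>0$. Put $$\alpha(x,y)=\frac{y-x}{|y-x|^{n/2+\beta(x)+1}}\,1_{\{|y-x|\le\epsilon\}},\qquad \Omega_{\mathcal I}=\{y\in\mathbb R^n\setminus\Omega:\ \alpha(x,y)\ne0\text{ for some }x\in\Omega\},\qquad \tilde\Omega=\Omega\cup\Omega_{\mathcal I},$$ where $\beta$ is a real function, continuous on $\tilde\Omega$, with $0<\beta_*\le\beta(x)\le\beta^*<1$ for $x\in\tilde\Omega$ and constants $\beta_*,\beta^*$. Let $a(t,x,y)=(a_{ij}(t,x,y))_{1\le i,j\le n}$ be symmetric, with $a_{ij}\in C^1([0,T]\times\mathbb R^n\times\mathbb R^n)$, and suppose that there are constants $a_*>0$ and $a^*$ with $$a_*|\xi|^2\le\sum_{i,j}a_{ij}(t,x,y)\xi_i\xi_j\le a^*|\xi|^2,\qquad \sum_{i,j}\partial_ta_{ij}(t,x,y)\xi_i\xi_j\le a^*|\xi|^2$$ for all $\xi\in\mathbb R^n$, $t\in[0,T]$ and $x,y\in\tilde\Omega$ with $|y-x|\le\epsilon$.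 For $u\in L^2(\tilde\Omega)$ let $\mathcal D^*(u)(x,y)=-(u(y)-u(x))\alpha(x,y)$ and, for $t\in[0,T]$, $$|||u|||=\Big(\tfrac12\int_{\tilde\Omega}\int_{\tilde\Omega}\mathcal D^*(u)(x,y)\cdot\big(a(t,x,y)\,\mathcal D^*(u)(x,y)\big)\,dy\,dx\Big)^{1/2},$$ $$\|u\|_{H^{\beta(\cdot)}(\tilde\Omega)}=\|u\|_{L^2(\tilde\Omega)}+\Big(\int_{\tilde\Omega}\int_{\tilde\Omega}\frac{(u(y)-u(x))^2}{|y-x|^{n+2\beta(x)}}\,dy\,dx\Big)^{1/2}.$$ Consider one of two volume constraints: $E_c(u)=\int_{\Omega_{\mathcal I}}u^2\,dx$ (Dirichlet) or $E_c(u)=\big(\int_{\tilde\Omega}u\,dx\big)^2$ (Neumann). In the Neumann case assume in addition that $\epsilon<\infty$ and that any two points of $\tilde\Omega$ can be joined by a finite chain of points of $\tilde\Omega$ with consecutive distances less than $\epsilon$ (which holds, for example, if $\tilde\Omega$ is connected). Let $$V_c(\tilde\Omega)=\{u\in L^2(\tilde\Omega):\ |||u|||<\infty,\ E_c(u)=0\},\qquad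 H^{\beta(\cdot)}_c(\tilde\Omega)=\{u\in L^2(\tilde\Omega):\ \|u\|_{H^{\beta(\cdot)}(\tilde\Omega)}<\infty,\ E_c(u)=0\},$$ where the first space is formed with the norm $|||\cdot|||$ at time $t$. Then there is a constant $C>0$, independent of $t\in[0,T]$ and of $u$, such that for every $t\in[0,T]$ $$C^{-1}\|u\|_{H^{\beta(\cdot)}(\tilde\Omega)}\le|||u|||\le C\,\|u\|_{H^{\beta(\cdot)}(\tilde\Omega)}\qquad\text{for all }u\in V_c(\tilde\Omega).$$ In addition, for every $t\in[0,T]$, the spaces $H^{\beta(\cdot)}_c(\tilde\Omega)$ and $V_c(\tilde\Omega)$ coincide. -/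

import Mathlib

open MeasureTheory Set
open scoped ENNReal NNReal Matrix

noncomputable section

namespace NonlocalDiffusion

/-- Euclidean space of dimension `n`. -/
abbrev Sp (n : ℕ) : Type := EuclideanSpace ℝ (Fin n)

/-- The two kinds of volume constraints. -/
inductive VolumeConstraint : Type
  | dirichlet
  | neumann

variable {n : ℕ}

/-- The vector kernel `α(x,y) = (y - x) / |y - x| ^ (n/2 + β(x) + 1)` if `|y - x| ≤ ε`, and `0`
otherwise. The horizon `ε` is an element of `[0,∞]`. The additional restriction `y ∈ Ω ∪ Ω_I` in
the truncation is automatic below, because the kernel is used only for `x, y ∈ Ω ∪ Ω_I` (and, in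
the definition of `Ω_I`, to decide which points interact with `Ω`). -/
def alpha (β : Sp n → ℝ) (ε : ℝ≥0∞) (x y : Sp n) : Sp n :=
  open scoped Classical in
  if edist y x ≤ ε then (‖y - x‖ ^ ((n : ℝ) / 2 + β x + 1))⁻¹ • (y - x) else 0

/-- The interaction domain `Ω_I`: the points outside `Ω` that interact with a point of `Ω`. -/
def interactionDomain (β : Sp n → ℝ) (ε : ℝ≥0∞) (Ω : Set (Sp n)) : Set (Sp n) :=
  {y | y ∉ Ω ∧ ∃ x ∈ Ω, alpha β ε x y ≠ 0}

/-- The set `Ω ∪ Ω_I`. -/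
def fullDomain (β : Sp n → ℝ) (ε : ℝ≥0∞) (Ω : Set (Sp n)) : Set (Sp n) :=
  Ω ∪ interactionDomain β ε Ω

/-- The real Hilbert space `L²(Ω ∪ Ω_I)` (classes of functions modulo a.e. equality). -/
abbrev L2 (β : Sp n → ℝ) (ε : ℝ≥0∞) (Ω : Set (Sp n)) : Type :=
  Lp ℝ 2 (volume.restrict (fullDomain β ε Ω))

/-- The adjoint nonlocal divergence `D*(u)(x,y) = -(u(y) - u(x)) α(x,y)`. -/
def Dstar (β : Sp n → ℝ) (ε : ℝ≥0∞) (u : Sp n → ℝ) (x y : Sp n) : Sp n :=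
  (-(u y - u x)) • alpha β ε x y

/-- The standing assumptions on the diffusion tensor `a(t,x,y)`: entries of class `C¹` on
`[0,T] × ℝⁿ × ℝⁿ`, symmetry, uniform ellipticity with constants `aLow` and `aUp`, and the
one-sided bound on the time derivative, the last two for `x, y ∈ S` with `|y - x| ≤ ε`
(where `S` will be `Ω ∪ Ω_I`). -/
structure IsDiffusionTensor (T : ℝ) (ε : ℝ≥0∞) (S : Set (Sp n)) (aLow aUp : ℝ)
    (a : ℝ → Sp n → Sp n → Matrix (Fin n) (Fin n) ℝ) : Prop where
  contDiffOn : ∀ i j, ContDiffOn ℝ 1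
    (fun p : ℝ × Sp n × Sp n => a p.1 p.2.1 p.2.2 i j) (Icc (0 : ℝ) T ×ˢ univ)
  symm : ∀ t ∈ Icc (0 : ℝ) T, ∀ x y i j, a t x y i j = a t x y j i
  aLow_pos : 0 < aLow
  lower : ∀ t ∈ Icc (0 : ℝ) T, ∀ x ∈ S, ∀ y ∈ S, edist y x ≤ ε → ∀ ξ : Sp n,
    aLow * ‖ξ‖ ^ 2 ≤ ∑ i, ∑ j, a t x y i j * ξ i * ξ j
  upper : ∀ t ∈ Icc (0 : ℝ) T, ∀ x ∈ S, ∀ y ∈ S, edist y x ≤ ε → ∀ ξ : Sp n,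
    ∑ i, ∑ j, a t x y i j * ξ i * ξ j ≤ aUp * ‖ξ‖ ^ 2
  deriv_upper : ∀ t ∈ Icc (0 : ℝ) T, ∀ x ∈ S, ∀ y ∈ S, edist y x ≤ ε → ∀ ξ : Sp n,
    ∑ i, ∑ j, derivWithin (fun s => a s x y i j) (Icc (0 : ℝ) T) t * ξ i * ξ j ≤ aUp * ‖ξ‖ ^ 2

/-- The nonlocal energy norm at time `t`, with values in `[0,∞]`:
`|||u|||² = 1/2 ∫∫ D*(u)(x,y) · (a(t,x,y) D*(u)(x,y)) dy dx`, both integrals over `Ω ∪ Ω_I`. -/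
def energyNorm (β : Sp n → ℝ) (ε : ℝ≥0∞) (Ω : Set (Sp n))
    (a : ℝ → Sp n → Sp n → Matrix (Fin n) (Fin n) ℝ) (t : ℝ) (u : L2 β ε Ω) : ℝ≥0∞ :=
  (2⁻¹ * ∫⁻ x in fullDomain β ε Ω, ∫⁻ y in fullDomain β ε Ω,
    ENNReal.ofReal ((Dstar β ε u x y).ofLp ⬝ᵥ (a t x y *ᵥ (Dstar β ε u x y).ofLp)))
      ^ (1 / 2 : ℝ)

/-- The seminorm `|u|` of the variable-order Sobolev space, with values in `[0,∞]`:
`|u|² = ∫∫ (u(y) - u(x))² / |y - x| ^ (n + 2 β(x)) dy dx`, both integrals over `Ω ∪ Ω_I`. -/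
def sobolevSeminorm (β : Sp n → ℝ) (ε : ℝ≥0∞) (Ω : Set (Sp n)) (u : L2 β ε Ω) : ℝ≥0∞ :=
  (∫⁻ x in fullDomain β ε Ω, ∫⁻ y in fullDomain β ε Ω,
    ENNReal.ofReal ((u y - u x) ^ 2 / ‖y - x‖ ^ ((n : ℝ) + 2 * β x))) ^ (1 / 2 : ℝ)

/-- The norm of the variable-order Sobolev space, with values in `[0,∞]`:
the `L²` norm plus the seminorm. -/
def sobolevNorm (β : Sp n → ℝ) (ε : ℝ≥0∞) (Ω : Set (Sp n)) (u : L2 β ε Ω) : ℝ≥0∞ :=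
  ‖u‖ₑ + sobolevSeminorm β ε Ω u

/-- The constraint functional `E_c`: the integral of `u²` over `Ω_I` in the Dirichlet case, and the
square of the integral of `u` over `Ω ∪ Ω_I` in the Neumann case. -/
def constraintFunctional (c : VolumeConstraint) (β : Sp n → ℝ) (ε : ℝ≥0∞) (Ω : Set (Sp n))
    (u : L2 β ε Ω) : ℝ :=
  match c with
  | .dirichlet => ∫ x in interactionDomain β ε Ω, (u x) ^ 2
  | .neumann => (∫ x in fullDomain β ε Ω, u x) ^ 2

/-- The nonlocal energy space `V(Ω ∪ Ω_I)` (at time `t`). -/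
def energySpace (β : Sp n → ℝ) (ε : ℝ≥0∞) (Ω : Set (Sp n))
    (a : ℝ → Sp n → Sp n → Matrix (Fin n) (Fin n) ℝ) (t : ℝ) : Set (L2 β ε Ω) :=
  {u | energyNorm β ε Ω a t u < ∞}

/-- The nonlocal volume-constrained energy space `V_c(Ω ∪ Ω_I)` (at time `t`). -/
def constrainedEnergySpace (c : VolumeConstraint) (β : Sp n → ℝ) (ε : ℝ≥0∞) (Ω : Set (Sp n))
    (a : ℝ → Sp n → Sp n → Matrix (Fin n) (Fin n) ℝ) (t : ℝ) : Set (L2 β ε Ω) :=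
  {u ∈ energySpace β ε Ω a t | constraintFunctional c β ε Ω u = 0}

/-- The variable-order Sobolev space on `Ω ∪ Ω_I`. -/
def sobolevSpace (β : Sp n → ℝ) (ε : ℝ≥0∞) (Ω : Set (Sp n)) : Set (L2 β ε Ω) :=
  {u | sobolevNorm β ε Ω u < ∞}

/-- The constrained variable-order Sobolev space on `Ω ∪ Ω_I`. -/
def constrainedSobolevSpace (c : VolumeConstraint) (β : Sp n → ℝ) (ε : ℝ≥0∞)
    (Ω : Set (Sp n)) : Set (L2 β ε Ω) :=
  {u ∈ sobolevSpace β ε Ω | constraintFunctional c β ε Ω u = 0}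

/-- Any two points of `S` are joined by a finite chain of points of `S` in which consecutive points
have distance less than `ε`. Every connected set has this property (for `ε > 0`). -/
def IsChainConnected (ε : ℝ≥0∞) (S : Set (Sp n)) : Prop :=
  ∀ x ∈ S, ∀ y ∈ S,
    Relation.ReflTransGen (fun p q : Sp n => p ∈ S ∧ q ∈ S ∧ edist p q < ε) x y

end NonlocalDiffusion

end

noncomputable section

namespace NonlocalDiffusion

/-! For pairs with `|y - x| ≤ ε`, ellipticity makes the energy density comparable to the Sobolev
density `(u(y) - u(x))² / |y - x|^(n + 2β(x))`; for the other pairs it vanishes. The bound of the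
energy by the Sobolev norm follows at once.

Conversely, pairs farther apart than a finite `ε` see a bounded kernel on a set of finite measure,
so they contribute at most a constant times `‖u‖²` (`IsDiffusionTensor.exists_sobolevIntegral_le`).
Everything thus reduces to a Poincaré inequality: under the constraint, `‖u‖²` is bounded by the
unweighted `nearEnergy`, hence by the energy (`IsDiffusionTensor.nearEnergy_le`).

The Poincaré inequality is proved by chaining, without compactness in function spaces. The
oscillation between two sets at mutual distance less than `R` is part of `nearEnergy`; averaging the
triangle inequality over an intermediate set (`Controlled.trans`) carries the bound along chains of
small balls, and a finite cover makes it global. In the Neumann case the oscillation over the whole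
domain dominates the `L²` norm of a mean-zero function. In the Dirichlet case a chain leads from
every point of `Ω` to a place where `u` vanishes on a set of positive measure
(`exists_chain_to_interactionDomain`). -/

/-- The squared difference `(u(y) - u(x))²`, with values in `[0,∞]`. -/
def sqDiff {X : Type*} (u : X → ℝ) (x y : X) : ℝ≥0∞ := ENNReal.ofReal ((u y - u x) ^ 2)

theorem sqDiff_comm {X : Type*} (u : X → ℝ) (x y : X) : sqDiff u x y = sqDiff u y x := by
  unfold sqDiff; congr 1; ring

theorem sqDiff_triangle {X : Type*} (u : X → ℝ) (x y z : X) :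
    sqDiff u x z ≤ 2 * (sqDiff u x y + sqDiff u z y) := by
  unfold sqDiff
  rw [← ENNReal.ofReal_add (sq_nonneg _) (sq_nonneg _), ← ENNReal.ofReal_ofNat 2,
    ← ENNReal.ofReal_mul (by norm_num)]
  apply ENNReal.ofReal_le_ofReal
  nlinarith [sq_nonneg ((u y - u x) + (u y - u z))]

theorem measurable_uncurry_sqDiff {X : Type*} [MeasurableSpace X] {u : X → ℝ}
    (hu : Measurable u) : Measurable (fun p : X × X => sqDiff u p.1 p.2) := by
  unfold sqDiff; fun_prop

theorem measurable_sqDiff_right {X : Type*} [MeasurableSpace X] {u : X → ℝ}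
    (hu : Measurable u) (x : X) : Measurable (fun y => sqDiff u x y) := by
  unfold sqDiff; fun_prop

/-! ### Poincaré inequalities by chaining, in a pseudometric measure space. -/

section Poincare

variable {X : Type*} [PseudoMetricSpace X] [MeasurableSpace X]

/-- The unweighted interaction energy of `u` over the pairs of points of `S` at distance `< R`. -/
def nearEnergy (μ : Measure X) (S : Set X) (R : ℝ) (u : X → ℝ) : ℝ≥0∞ :=
  ∫⁻ x in S, ∫⁻ y in S ∩ Metric.ball x R, sqDiff u x y ∂μ ∂μ

/-- The mean square oscillation between `U` and `V` is bounded by the interaction energy. -/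
def Controlled (μ : Measure X) (S : Set X) (R : ℝ) (U V : Set X) : Prop :=
  ∃ C : ℝ≥0, ∀ u : X → ℝ, Measurable u →
    ∫⁻ x in U, ∫⁻ y in V, sqDiff u x y ∂μ ∂μ ≤ C * nearEnergy μ S R u

variable {μ : Measure X} {S : Set X} {R : ℝ} {U V W : Set X}

theorem Controlled.of_dist_lt (hU : MeasurableSet U) (hUS : U ⊆ S) (hVS : V ⊆ S)
    (h : ∀ x ∈ U, ∀ y ∈ V, dist y x < R) : Controlled μ S R U V := by
  refine ⟨1, fun u _ => ?_⟩
  rw [ENNReal.coe_one, one_mul]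
  refine (setLIntegral_mono' hU fun x hx => ?_).trans (lintegral_mono_set hUS)
  exact lintegral_mono_set fun y hy => ⟨hVS hy, h x hx y hy⟩

theorem Controlled.mono {U' V' : Set X} (h : Controlled μ S R U V) (hU : U' ⊆ U) (hV : V' ⊆ V) :
    Controlled μ S R U' V' := by
  obtain ⟨C, hC⟩ := h
  refine ⟨C, fun u hu => le_trans ?_ (hC u hu)⟩
  exact (lintegral_mono_set hU).trans (lintegral_mono fun x => lintegral_mono_set hV)

theorem Controlled.symm [SFinite μ] (h : Controlled μ S R U V) : Controlled μ S R V U := by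
  obtain ⟨C, hC⟩ := h
  refine ⟨C, fun u hu => le_trans (le_of_eq ?_) (hC u hu)⟩
  rw [lintegral_lintegral_swap (measurable_uncurry_sqDiff hu).aemeasurable]
  simp_rw [sqDiff_comm u]

/-- Integrate `sqDiff_triangle` over the intermediate point `y ∈ V` and divide by `μ V`; this is why
`V` must have positive measure. -/
theorem Controlled.trans [SFinite μ] (h₁ : Controlled μ S R U V) (h₂ : Controlled μ S R V W)
    (hV0 : μ V ≠ 0) (hV : μ V ≠ ∞) (hU : μ U ≠ ∞) (hW : μ W ≠ ∞) : Controlled μ S R U W := by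
  obtain ⟨C₁, h₁⟩ := h₁
  obtain ⟨C₂, h₂⟩ := h₂.symm
  lift μ V to ℝ≥0 using hV with v hv
  lift μ U to ℝ≥0 using hU with a ha
  lift μ W to ℝ≥0 using hW with b hb
  have hv0 : v ≠ 0 := by simpa using hV0
  -- Here `v`, `a`, `b` are the measures of `V`, `U`, `W`: the term in `(x, y)` does not depend on
  -- `z ∈ W`, the term in `(z, y)` not on `x ∈ U`.
  refine ⟨v⁻¹ * (2 * (b * C₁ + a * C₂)), fun u hu => ?_⟩
  have key : (v : ℝ≥0∞) * ∫⁻ x in U, ∫⁻ z in W, sqDiff u x z ∂μ ∂μ ≤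
      2 * (b * (C₁ * nearEnergy μ S R u) + a * (C₂ * nearEnergy μ S R u)) := by
    calc (v : ℝ≥0∞) * ∫⁻ x in U, ∫⁻ z in W, sqDiff u x z ∂μ ∂μ
        = ∫⁻ x in U, ∫⁻ z in W, ∫⁻ _ in V, sqDiff u x z ∂μ ∂μ ∂μ := by
          simp_rw [setLIntegral_const, ← hv]
          rw [← lintegral_const_mul' _ _ ENNReal.coe_ne_top]
          refine lintegral_congr fun x => ?_
          rw [lintegral_mul_const' _ _ ENNReal.coe_ne_top, mul_comm]
      _ ≤ ∫⁻ x in U, ∫⁻ z in W, ∫⁻ y in V, 2 * (sqDiff u x y + sqDiff u z y) ∂μ ∂μ ∂μ :=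
          lintegral_mono fun x => lintegral_mono fun z => lintegral_mono fun y =>
            sqDiff_triangle u x y z
      _ = 2 * (b * (∫⁻ x in U, ∫⁻ y in V, sqDiff u x y ∂μ ∂μ)
            + a * ∫⁻ z in W, ∫⁻ y in V, sqDiff u z y ∂μ ∂μ) := by
          simp_rw [lintegral_const_mul' _ _ ENNReal.ofNat_ne_top,
            lintegral_add_left (measurable_sqDiff_right hu _)]
          simp_rw [lintegral_add_left measurable_const, setLIntegral_const, ← hb]
          rw [lintegral_add_right _ measurable_const, setLIntegral_const, ← ha,
            lintegral_mul_const' _ _ ENNReal.coe_ne_top]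
          ring
      _ ≤ _ := by gcongr; exacts [h₁ u hu, h₂ u hu]
  have hv' : (v : ℝ≥0∞) ≠ 0 := by simpa using hv0
  calc _ = (v : ℝ≥0∞)⁻¹ * ((v : ℝ≥0∞) * ∫⁻ x in U, ∫⁻ z in W, sqDiff u x z ∂μ ∂μ) := by
        rw [← mul_assoc, ENNReal.inv_mul_cancel hv' ENNReal.coe_ne_top, one_mul]
    _ ≤ (v : ℝ≥0∞)⁻¹ *
        (2 * (b * (C₁ * nearEnergy μ S R u) + a * (C₂ * nearEnergy μ S R u))) := by gcongr
    _ = _ := by push_cast [ENNReal.coe_inv hv0]; ring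

theorem Controlled.biUnion_left {ι : Type*} {t : Set ι} (ht : t.Finite) {U : ι → Set X}
    (h : ∀ i ∈ t, Controlled μ S R (U i) V) : Controlled μ S R (⋃ i ∈ t, U i) V := by
  induction t, ht using Set.Finite.induction_on with
  | empty => exact ⟨0, fun u _ => by simp⟩
  | insert _ _ ih =>
    obtain ⟨C₁, h₁⟩ := ih fun i hi => h i (mem_insert_of_mem _ hi)
    obtain ⟨C₂, h₂⟩ := h _ (mem_insert _ _)
    refine ⟨C₂ + C₁, fun u hu => ?_⟩
    rw [biUnion_insert, ENNReal.coe_add, add_mul]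
    exact (lintegral_union_le _ _ _).trans (add_le_add (h₂ u hu) (h₁ u hu))

/-- For almost every `y ∈ V ∩ Z` the squared difference is just `u(x)²`, so the double integral over
`U` and `V ∩ Z` is `μ (V ∩ Z)` times the integral sought. -/
theorem Controlled.exists_lintegral_sq_le {Z : Set X} (h : Controlled μ S R U V)
    (h0 : μ (V ∩ Z) ≠ 0) (hV : μ V ≠ ∞) :
    ∃ C : ℝ≥0, ∀ u : X → ℝ, Measurable u → (∀ᵐ y ∂μ.restrict Z, u y = 0) →
      ∫⁻ x in U, ENNReal.ofReal (u x ^ 2) ∂μ ≤ C * nearEnergy μ S R u := by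
  obtain ⟨C, hC⟩ := h.mono subset_rfl (inter_subset_left (t := Z))
  have hfin : μ (V ∩ Z) ≠ ∞ := measure_ne_top_of_subset inter_subset_left hV
  lift μ (V ∩ Z) to ℝ≥0 using hfin with v hv
  have hv0 : v ≠ 0 := by simpa using h0
  refine ⟨v⁻¹ * C, fun u hu hz => ?_⟩
  have hz' := ae_restrict_of_ae_restrict_of_subset (inter_subset_right (s := V)) hz
  have key : (v : ℝ≥0∞) * ∫⁻ x in U, ENNReal.ofReal (u x ^ 2) ∂μ ≤ C * nearEnergy μ S R u := by
    refine le_trans (le_of_eq ?_) (hC u hu)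
    rw [← lintegral_const_mul' _ _ ENNReal.coe_ne_top]
    refine lintegral_congr fun x => ?_
    rw [hv, mul_comm, ← setLIntegral_const]
    refine lintegral_congr_ae ?_
    filter_upwards [hz'] with y hy
    simp [sqDiff, hy]
  have hv' : (v : ℝ≥0∞) ≠ 0 := by simpa using hv0
  calc _ = (v : ℝ≥0∞)⁻¹ * ((v : ℝ≥0∞) * ∫⁻ x in U, ENNReal.ofReal (u x ^ 2) ∂μ) := by
        rw [← mul_assoc, ENNReal.inv_mul_cancel hv' ENNReal.coe_ne_top, one_mul]
    _ ≤ (v : ℝ≥0∞)⁻¹ * (C * nearEnergy μ S R u) := by gcongr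
    _ = _ := by push_cast [ENNReal.coe_inv hv0]; ring

/-- One step of a chain in `S` with consecutive distances less than `R`. -/
abbrev ChainStep (S : Set X) (R : ℝ) (p q : X) : Prop := p ∈ S ∧ q ∈ S ∧ dist p q < R

theorem exists_finite_cover_balls {Y : Type*} [PseudoMetricSpace Y] [ProperSpace Y] {U : Set Y}
    (hb : Bornology.IsBounded U) {R : ℝ} (hR : 0 < R) :
    ∃ t ⊆ U, t.Finite ∧ U ⊆ ⋃ c ∈ t, Metric.ball c (R / 2) :=
  Metric.finite_approx_of_totallyBounded
    (hb.isCompact_closure.totallyBounded.subset subset_closure) _ (half_pos hR)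

variable [BorelSpace X]

open Filter Topology in
-- Stated for all small radii, so that the finitely many steps of a chain can share one `δ`.
theorem eventually_controlled_ball (hS : IsOpen S) {p q : X} (hp : p ∈ S) (hq : q ∈ S)
    (h : dist p q < R) :
    ∀ᶠ δ in 𝓝[>] (0 : ℝ), Controlled μ S R (Metric.ball p δ) (Metric.ball q δ) := by
  obtain ⟨r₁, hr₁, hp'⟩ := Metric.isOpen_iff.1 hS p hp
  obtain ⟨r₂, hr₂, hq'⟩ := Metric.isOpen_iff.1 hS q hq
  have hpos : 0 < min (min r₁ r₂) ((R - dist p q) / 2) := by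
    have : 0 < R - dist p q := by linarith
    positivity
  filter_upwards [Ioo_mem_nhdsGT hpos] with δ hδ
  obtain ⟨-, h1⟩ := hδ
  simp only [lt_min_iff] at h1
  refine .of_dist_lt measurableSet_ball ((Metric.ball_subset_ball h1.1.1.le).trans hp')
    ((Metric.ball_subset_ball h1.1.2.le).trans hq') fun x hx y hy => ?_
  rw [Metric.mem_ball] at hx hy
  have h3 := dist_triangle4 y q p x
  rw [dist_comm p x, dist_comm q p] at h3
  linarith

open Filter Topology in
-- Passes from a covering piece of fixed radius `R / 2` to an arbitrarily small ball, where a chain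
-- can start.
theorem eventually_controlled_inter_ball (hS : IsOpen S) (hR : 0 < R) {p : X} (hp : p ∈ S) :
    ∀ᶠ δ in 𝓝[>] (0 : ℝ), Controlled μ S R (S ∩ Metric.ball p (R / 2)) (Metric.ball p δ) := by
  obtain ⟨r₁, hr₁, hp'⟩ := Metric.isOpen_iff.1 hS p hp
  filter_upwards [Ioo_mem_nhdsGT hr₁, Ioo_mem_nhdsGT (half_pos hR)] with δ h1 h2
  refine .of_dist_lt (hS.inter Metric.isOpen_ball).measurableSet inter_subset_left
    ((Metric.ball_subset_ball h1.2.le).trans hp') fun x hx y hy => ?_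
  have h3 := dist_triangle_right y x p
  have := Metric.mem_ball.1 hx.2
  have := Metric.mem_ball.1 hy
  linarith [h2.2]

variable [ProperSpace X] [IsFiniteMeasureOnCompacts μ] [μ.IsOpenPosMeasure]

open Filter Topology in
theorem eventually_controlled_ball_of_chain (hS : IsOpen S) (hR : 0 < R) {p q : X} (hp : p ∈ S)
    (h : Relation.ReflTransGen (ChainStep S R) p q) :
    ∀ᶠ δ in 𝓝[>] (0 : ℝ), Controlled μ S R (Metric.ball p δ) (Metric.ball q δ) := by
  induction h with
  | refl => exact eventually_controlled_ball hS hp hp (by simpa using hR)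
  | tail _ hs ih =>
    filter_upwards [ih, eventually_controlled_ball (μ := μ) hS hs.1 hs.2.1 hs.2.2,
      self_mem_nhdsWithin] with δ h1 h2 h3
    exact h1.trans h2 (Metric.measure_ball_pos μ _ h3).ne' measure_ball_lt_top.ne
      measure_ball_lt_top.ne measure_ball_lt_top.ne

open Filter Topology in
theorem eventually_controlled_inter_ball_of_chain (hS : IsOpen S) (hR : 0 < R) {p q : X}
    (hp : p ∈ S) (h : Relation.ReflTransGen (ChainStep S R) p q) :
    ∀ᶠ δ in 𝓝[>] (0 : ℝ), Controlled μ S R (S ∩ Metric.ball p (R / 2)) (Metric.ball q δ) := by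
  filter_upwards [eventually_controlled_inter_ball (μ := μ) hS hR hp,
    eventually_controlled_ball_of_chain (μ := μ) hS hR hp h, self_mem_nhdsWithin] with δ h1 h2 h3
  exact h1.trans h2 (Metric.measure_ball_pos μ _ h3).ne' measure_ball_lt_top.ne
    (measure_ne_top_of_subset inter_subset_right measure_ball_lt_top.ne) measure_ball_lt_top.ne

/-- The oscillation over a bounded chain connected open set is bounded by the interaction energy. -/
theorem controlled_self_of_chain (hS : IsOpen S) (hb : Bornology.IsBounded S) (hR : 0 < R)
    (h : ∀ x ∈ S, ∀ y ∈ S, Relation.ReflTransGen (ChainStep S R) x y) :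
    Controlled μ S R S S := by
  obtain ⟨t, htS, htf, hcov⟩ := exists_finite_cover_balls hb hR
  have hloc : ∀ p ∈ t, ∀ q ∈ t, Controlled μ S R (S ∩ Metric.ball p (R / 2))
      (S ∩ Metric.ball q (R / 2)) := fun p hp q hq => by
    obtain ⟨δ, ⟨h1, h2⟩, h3⟩ :=
      (((eventually_controlled_inter_ball_of_chain (μ := μ) hS hR (htS hp)
        (h p (htS hp) q (htS hq))).and (eventually_controlled_inter_ball (μ := μ) hS hR
        (htS hq))).and self_mem_nhdsWithin).exists
    exact h1.trans h2.symm (Metric.measure_ball_pos μ _ h3).ne' measure_ball_lt_top.ne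
      (measure_ne_top_of_subset inter_subset_right measure_ball_lt_top.ne)
      (measure_ne_top_of_subset inter_subset_right measure_ball_lt_top.ne)
  have hsub : S ⊆ ⋃ c ∈ t, S ∩ Metric.ball c (R / 2) := by
    rw [← inter_iUnion₂]; exact subset_inter subset_rfl hcov
  -- Unions are taken in the first argument only, so `symm` exchanges the two sides between the two
  -- unions.
  exact (Controlled.biUnion_left htf fun p hp => (Controlled.biUnion_left htf fun q hq =>
    (hloc p hp q hq).symm).symm).mono hsub hsub

/-- A nonlocal Poincaré inequality for functions vanishing on a set `Z` that can be reached, up to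
sets of measure zero, by chains starting in `U`. -/
theorem exists_lintegral_sq_le_of_chain {Z : Set X} (hS : IsOpen S) (hUS : U ⊆ S)
    (hb : Bornology.IsBounded U) (hR : 0 < R)
    (h : ∀ p ∈ U, ∃ q, Relation.ReflTransGen (ChainStep S R) p q ∧
      ∀ δ > 0, μ (Metric.ball q δ ∩ Z) ≠ 0) :
    ∃ C : ℝ≥0, ∀ u : X → ℝ, Measurable u → (∀ᵐ y ∂μ.restrict Z, u y = 0) →
      ∫⁻ x in U, ENNReal.ofReal (u x ^ 2) ∂μ ≤ C * nearEnergy μ S R u := by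
  obtain ⟨t, htU, htf, hcov⟩ := exists_finite_cover_balls hb hR
  have hloc : ∀ p ∈ t, ∃ C : ℝ≥0, ∀ u : X → ℝ, Measurable u → (∀ᵐ y ∂μ.restrict Z, u y = 0) →
      ∫⁻ x in S ∩ Metric.ball p (R / 2), ENNReal.ofReal (u x ^ 2) ∂μ
        ≤ C * nearEnergy μ S R u := fun p hp => by
    obtain ⟨q, hq, hZ⟩ := h p (htU hp)
    obtain ⟨δ, h1, h3⟩ := ((eventually_controlled_inter_ball_of_chain (μ := μ) hS hR
      (hUS (htU hp)) hq).and self_mem_nhdsWithin).exists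
    exact h1.exists_lintegral_sq_le (hZ δ h3) measure_ball_lt_top.ne
  have hsub : U ⊆ ⋃ c ∈ t, S ∩ Metric.ball c (R / 2) := by
    rw [← inter_iUnion₂]; exact subset_inter hUS hcov
  -- The covering of `U` is lost for subfamilies of `t`; the induction therefore bounds the integral
  -- over the union itself.
  suffices H : ∃ C : ℝ≥0, ∀ u : X → ℝ, Measurable u → (∀ᵐ y ∂μ.restrict Z, u y = 0) →
      ∫⁻ x in ⋃ c ∈ t, S ∩ Metric.ball c (R / 2), ENNReal.ofReal (u x ^ 2) ∂μ
        ≤ C * nearEnergy μ S R u by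
    obtain ⟨C, hC⟩ := H
    exact ⟨C, fun u hu hz => (lintegral_mono_set hsub).trans (hC u hu hz)⟩
  clear hcov hsub htU
  induction t, htf using Set.Finite.induction_on with
  | empty => exact ⟨0, fun u _ _ => by simp⟩
  | insert _ _ ih =>
    obtain ⟨C₁, h₁⟩ := ih fun i hi => hloc i (mem_insert_of_mem _ hi)
    obtain ⟨C₂, h₂⟩ := hloc _ (mem_insert _ _)
    refine ⟨C₂ + C₁, fun u hu hz => ?_⟩
    rw [biUnion_insert, ENNReal.coe_add, add_mul]
    exact (lintegral_union_le _ _ _).trans (add_le_add (h₂ u hu hz) (h₁ u hu hz))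

end Poincare

/-! ### Geometry of the interaction domain and the two Poincaré inequalities. -/

section Domain

variable {n : ℕ} {β : Sp n → ℝ} {ε : ℝ≥0∞} {Ω : Set (Sp n)}

theorem alpha_ne_zero_iff {x y : Sp n} : alpha β ε x y ≠ 0 ↔ edist y x ≤ ε ∧ y ≠ x := by
  unfold alpha
  split_ifs with h
  · rw [smul_ne_zero_iff, sub_ne_zero]
    refine ⟨fun h' => ⟨h, h'.2⟩, fun h' => ⟨?_, h'.2⟩⟩
    exact inv_ne_zero (Real.rpow_pos_of_pos (norm_pos_iff.2 (sub_ne_zero.2 h'.2)) _).ne'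
  · simp [h]

theorem mem_fullDomain_iff {y : Sp n} :
    y ∈ fullDomain β ε Ω ↔ ∃ x ∈ Ω, edist y x ≤ ε := by
  simp only [fullDomain, interactionDomain, mem_union, mem_ofPred_eq, alpha_ne_zero_iff]
  constructor
  · rintro (h | ⟨-, x, hx, h, -⟩)
    exacts [⟨y, h, by simp⟩, ⟨x, hx, h⟩]
  · rintro ⟨x, hx, h⟩
    by_cases hy : y ∈ Ω
    · exact Or.inl hy
    · exact Or.inr ⟨hy, x, hx, h, fun e => hy (e ▸ hx)⟩

theorem interactionDomain_eq_diff : interactionDomain β ε Ω = fullDomain β ε Ω \ Ω := by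
  ext y
  simp only [fullDomain, mem_sdiff, mem_union]
  constructor
  · intro h
    exact ⟨Or.inr h, h.1⟩
  · rintro ⟨h | h, h'⟩
    exacts [absurd h h', h]

/-- Although the horizon condition is closed, moving `y` and its partner `x ∈ Ω` by the same vector
keeps their distance, and `Ω` is open. -/
theorem isOpen_fullDomain (hΩ : IsOpen Ω) : IsOpen (fullDomain β ε Ω) := by
  rw [Metric.isOpen_iff]
  intro y hy
  obtain ⟨x, hx, hxy⟩ := mem_fullDomain_iff.1 hy
  obtain ⟨r, hr, hsub⟩ := Metric.isOpen_iff.1 hΩ x hx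
  refine ⟨r, hr, fun y' hy' => mem_fullDomain_iff.2 ⟨x + (y' - y), hsub ?_, ?_⟩⟩
  · simpa [dist_eq_norm] using hy'
  · rw [edist_eq_enorm_sub] at hxy ⊢
    convert hxy using 2
    abel

theorem isBounded_fullDomain (hΩb : Bornology.IsBounded Ω) (hε : ε ≠ ∞) :
    Bornology.IsBounded (fullDomain β ε Ω) := by
  refine (hΩb.cthickening (δ := ε.toReal)).subset fun y hy => ?_
  obtain ⟨x, hx, hxy⟩ := mem_fullDomain_iff.1 hy
  rw [Metric.mem_cthickening_iff, ENNReal.ofReal_toReal hε]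
  exact (Metric.infEDist_le_edist_of_mem hx).trans hxy

/-- March in a fixed unit direction `e`. A jump of length `R / 2` from a point of `Ω` stays in the
full domain; either it lands where every ball meets the interaction domain in positive measure, or
there is a point of `Ω` nearby from which to continue. Boundedness of `Ω` ends the march. Positive
measure is needed since the constraint holds only almost everywhere. -/
theorem exists_chain_to_interactionDomain (hn : 1 ≤ n) (hΩ : IsOpen Ω)
    (hΩb : Bornology.IsBounded Ω) {R : ℝ} (hR : 0 < R) (hRε : ENNReal.ofReal R ≤ ε) {p : Sp n}
    (hp : p ∈ Ω) :
    ∃ q, Relation.ReflTransGen (ChainStep (fullDomain β ε Ω) R) p q ∧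
      ∀ δ > 0, volume (Metric.ball q δ ∩ interactionDomain β ε Ω) ≠ 0 := by
  set S := fullDomain β ε Ω with hSdef
  have hΩS : Ω ⊆ S := subset_union_left
  obtain ⟨e, he⟩ : ∃ e : Sp n, ‖e‖ = 1 := ⟨EuclideanSpace.single ⟨0, hn⟩ 1, by simp⟩
  obtain ⟨M, hM⟩ := hΩb.exists_norm_le
  have hle : ∀ x ∈ Ω, inner ℝ e x ≤ M := fun x hx => by
    have := real_inner_le_norm e x
    rw [he, one_mul] at this
    exact this.trans (hM x hx)
  -- The index `k` bounds the remaining height below `M` in units of `R / 4`; for `k = 0` no point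
  -- of `Ω` qualifies.
  have main : ∀ k : ℕ, ∀ p ∈ Ω, M - k * (R / 4) < inner ℝ e p →
      ∃ q, Relation.ReflTransGen (ChainStep S R) p q ∧
        ∀ δ > 0, volume (Metric.ball q δ ∩ interactionDomain β ε Ω) ≠ 0 := by
    intro k
    induction k with
    | zero => intro p hp h; have := hle p hp; simp at h; linarith
    | succ k ih =>
      intro p hp h
      set q := p + (R / 2) • e with hq
      have hpq : dist p q = R / 2 := by
        rw [hq, dist_self_add_right, norm_smul, he, mul_one, Real.norm_of_nonneg (by positivity)]
      have hqS : q ∈ S := mem_fullDomain_iff.2 ⟨p, hp, by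
        rw [edist_dist, dist_comm, hpq]
        exact (ENNReal.ofReal_le_ofReal (by linarith)).trans hRε⟩
      by_cases hpos : ∀ δ > 0, volume (Metric.ball q δ ∩ interactionDomain β ε Ω) ≠ 0
      · exact ⟨q, .single ⟨hΩS hp, hqS, by linarith⟩, hpos⟩
      · push Not at hpos
        obtain ⟨δ, hδ, hnull⟩ := hpos
        obtain ⟨r, hr, hsub⟩ := Metric.isOpen_iff.1
          (isOpen_fullDomain (β := β) (ε := ε) hΩ) q hqS
        have hρ : 0 < min (min δ r) (R / 8) := by positivity
        -- Otherwise this whole ball around `q`, which lies in the full domain, would be contained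
        -- in the interaction domain and in a null set.
        obtain ⟨p', hp'q, hp'⟩ : ∃ p' ∈ Metric.ball q (min (min δ r) (R / 8)), p' ∈ Ω := by
          by_contra! hcon
          refine (Metric.measure_ball_pos volume q hρ).ne' (measure_mono_null ?_ hnull)
          intro z hz
          have hz' : dist z q < min (min δ r) (R / 8) := hz
          simp only [lt_min_iff] at hz'
          rw [interactionDomain_eq_diff]
          exact ⟨hz'.1.1, hsub hz'.1.2, hcon z hz⟩
        have hd : dist p' q < R / 8 := lt_of_lt_of_le hp'q (min_le_right _ _)
        have hin : inner ℝ e q - R / 8 < inner ℝ e p' := by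
          have h1 := real_inner_le_norm e (q - p')
          rw [he, one_mul, inner_sub_right, ← dist_eq_norm, dist_comm] at h1
          linarith
        have hinq : inner ℝ e q = inner ℝ e p + R / 2 := by
          rw [hq, inner_add_right, inner_smul_right, real_inner_self_eq_norm_sq, he]; ring
        push_cast at h
        -- The height gained is more than `R / 2 - R / 8`, hence more than `R / 4`, while `p'` is
        -- within `5R / 8 < R` of `p`.
        obtain ⟨q', hc, hq'⟩ := ih p' hp' (by nlinarith)
        have htri := dist_triangle_right p p' q
        exact ⟨q', .head ⟨hΩS hp, hΩS hp', by linarith⟩ hc, hq'⟩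
  obtain ⟨k, hk⟩ := exists_nat_gt ((M - inner ℝ e p) / (R / 4))
  rw [div_lt_iff₀ (by positivity)] at hk
  exact main k p hp (by linarith)

/-- The nonlocal Poincaré inequality under the homogeneous Dirichlet volume constraint. -/
theorem exists_lintegral_sq_le_of_dirichlet (hn : 1 ≤ n) (hΩ : IsOpen Ω)
    (hΩb : Bornology.IsBounded Ω) {R : ℝ} (hR : 0 < R) (hRε : ENNReal.ofReal R ≤ ε) :
    ∃ C : ℝ≥0, ∀ u : L2 β ε Ω, constraintFunctional .dirichlet β ε Ω u = 0 →
      ∫⁻ x in fullDomain β ε Ω, ENNReal.ofReal (u x ^ 2)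
        ≤ C * nearEnergy volume (fullDomain β ε Ω) R u := by
  obtain ⟨C, hC⟩ := exists_lintegral_sq_le_of_chain (μ := volume)
    (isOpen_fullDomain (β := β) (ε := ε) hΩ) subset_union_left hΩb hR
    fun p hp => exists_chain_to_interactionDomain hn hΩ hΩb hR hRε hp
  refine ⟨C, fun u hu => ?_⟩
  have hI : Integrable (fun x => u x ^ 2) (volume.restrict (interactionDomain β ε Ω)) :=
    (Lp.memLp u).integrable_sq.mono_measure (Measure.restrict_mono subset_union_right le_rfl)
  have hz : ∀ᵐ y ∂volume.restrict (interactionDomain β ε Ω), u y = 0 := by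
    have := (integral_eq_zero_iff_of_nonneg (fun x => sq_nonneg _) hI).1 hu
    filter_upwards [this] with y hy
    simpa using hy
  refine le_trans ?_ (hC u (Lp.stronglyMeasurable u).measurable hz)
  refine (lintegral_union_le _ _ _).trans (le_of_eq ?_)
  convert add_zero _
  refine (lintegral_congr_ae (g := 0) ?_).trans lintegral_zero
  filter_upwards [hz] with y hy
  simp [hy]

/-- For mean zero, `∫ (u(y) - u(x))² dy = ∫ u² + μ(X) u(x)²` for each fixed `x`; the first term is
dropped. -/
theorem measure_mul_lintegral_sq_le {X : Type*} [MeasurableSpace X] {μ : Measure X}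
    [IsFiniteMeasure μ] {u : X → ℝ} (hu : MemLp u 2 μ) (h0 : ∫ x, u x ∂μ = 0) :
    μ univ * ∫⁻ x, ENNReal.ofReal (u x ^ 2) ∂μ ≤ ∫⁻ x, ∫⁻ y, sqDiff u x y ∂μ ∂μ := by
  rw [← lintegral_const_mul' _ _ (measure_ne_top μ univ)]
  refine lintegral_mono fun x => ?_
  have h1 : Integrable u μ := hu.integrable (by norm_num)
  have h2 := hu.integrable_sq
  have heq : ∀ y, (u y - u x) ^ 2 = u y ^ 2 - 2 * u x * u y + u x ^ 2 := fun y => by ring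
  have h3 : Integrable (fun y => u y ^ 2 - 2 * u x * u y) μ := h2.sub (h1.const_mul _)
  have h4 : Integrable (fun y => (u y - u x) ^ 2) μ := by
    simp_rw [heq]
    exact h3.add (integrable_const _)
  simp only [sqDiff]
  rw [← ofReal_integral_eq_lintegral_ofReal h4 (.of_forall fun y => sq_nonneg _),
    ← ofReal_measureReal, ← ENNReal.ofReal_mul measureReal_nonneg]
  apply ENNReal.ofReal_le_ofReal
  simp_rw [heq]
  rw [integral_add h3 (integrable_const _), integral_sub h2 (h1.const_mul _),
    integral_const_mul, h0, integral_const, smul_eq_mul]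
  have : 0 ≤ ∫ y, u y ^ 2 ∂μ := integral_nonneg fun y => sq_nonneg _
  linarith

/-- The nonlocal Poincaré inequality under the Neumann volume constraint. -/
theorem exists_lintegral_sq_le_of_neumann (hΩ : IsOpen Ω) (hΩb : Bornology.IsBounded Ω)
    (hε : 0 < ε) (hε' : ε ≠ ∞) (hchain : IsChainConnected ε (fullDomain β ε Ω)) :
    ∃ C : ℝ≥0, ∀ u : L2 β ε Ω, constraintFunctional .neumann β ε Ω u = 0 →
      ∫⁻ x in fullDomain β ε Ω, ENNReal.ofReal (u x ^ 2)
        ≤ C * nearEnergy volume (fullDomain β ε Ω) ε.toReal u := by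
  set S := fullDomain β ε Ω with hS
  have hSb : Bornology.IsBounded S := isBounded_fullDomain hΩb hε'
  have hstep : ∀ p q : Sp n, p ∈ S ∧ q ∈ S ∧ edist p q < ε → ChainStep S ε.toReal p q :=
    fun p q h => ⟨h.1, h.2.1, by
      rw [dist_edist]; exact (ENNReal.toReal_lt_toReal h.2.2.ne_top hε').2 h.2.2⟩
  obtain ⟨C, hC⟩ := controlled_self_of_chain (μ := volume)
    (isOpen_fullDomain (β := β) (ε := ε) hΩ) hSb (ENNReal.toReal_pos hε.ne' hε')
    fun x hx y hy => Relation.ReflTransGen.mono hstep x y (hchain x hx y hy)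
  by_cases h0 : volume S = 0
  · exact ⟨0, fun u _ => by rw [setLIntegral_measure_zero _ _ h0]; simp⟩
  have : IsFiniteMeasure (volume.restrict S) := isFiniteMeasure_restrict.2 hSb.measure_lt_top.ne
  have hfin : volume S ≠ ∞ := hSb.measure_lt_top.ne
  refine ⟨(volume S).toNNReal⁻¹ * C, fun u hu => ?_⟩
  have hmean : ∫ x in S, u x = 0 := pow_eq_zero_iff two_ne_zero |>.1 hu
  have h1 := (measure_mul_lintegral_sq_le (Lp.memLp u) hmean).trans
    (hC u (Lp.stronglyMeasurable u).measurable)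
  rw [Measure.restrict_apply_univ] at h1
  have h2 : (volume S).toNNReal ≠ 0 := ENNReal.toNNReal_ne_zero.2 ⟨h0, hfin⟩
  rw [ENNReal.coe_mul, ENNReal.coe_inv h2, ENNReal.coe_toNNReal hfin, mul_assoc]
  calc _ = (volume S)⁻¹ * (volume S * ∫⁻ x in S, ENNReal.ofReal (u x ^ 2)) := by
        rw [← mul_assoc, ENNReal.inv_mul_cancel h0 hfin, one_mul]
    _ ≤ _ := by gcongr

end Domain

/-! ### Comparison of the energy density, the Sobolev density and the squared difference. -/

section Kernel

variable {n : ℕ} {β : Sp n → ℝ} {ε : ℝ≥0∞} {Ω : Set (Sp n)}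

theorem norm_Dstar_sq (u : Sp n → ℝ) {x y : Sp n} (h : edist y x ≤ ε) :
    ‖Dstar β ε u x y‖ ^ 2 = (u y - u x) ^ 2 / ‖y - x‖ ^ ((n : ℝ) + 2 * β x) := by
  rcases eq_or_ne y x with rfl | hne
  · simp [Dstar]
  have hr : 0 < ‖y - x‖ := norm_pos_iff.2 (sub_ne_zero.2 hne)
  have e1 : ‖y - x‖ ^ ((n : ℝ) / 2 + β x + 1) = ‖y - x‖ ^ ((n : ℝ) / 2 + β x) * ‖y - x‖ := by
    rw [Real.rpow_add hr, Real.rpow_one]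
  have e2 : ‖y - x‖ ^ ((n : ℝ) + 2 * β x) = (‖y - x‖ ^ ((n : ℝ) / 2 + β x)) ^ 2 := by
    rw [← Real.rpow_mul_natCast hr.le]; congr 1; push_cast; ring
  have hp : 0 < ‖y - x‖ ^ ((n : ℝ) / 2 + β x) := Real.rpow_pos_of_pos hr _
  rw [Dstar, alpha, if_pos h, norm_smul, norm_smul, norm_neg, e2, e1, norm_inv, Real.norm_eq_abs,
    norm_mul, norm_norm, Real.norm_of_nonneg hp.le, mul_pow, sq_abs]
  field_simp

theorem dotProduct_mulVec_self (A : Matrix (Fin n) (Fin n) ℝ) (ξ : Sp n) :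
    ξ.ofLp ⬝ᵥ (A *ᵥ ξ.ofLp) = ∑ i, ∑ j, A i j * ξ i * ξ j := by
  simp only [dotProduct, Matrix.mulVec, Finset.mul_sum]
  exact Finset.sum_congr rfl fun i _ => Finset.sum_congr rfl fun j _ => by ring

variable {T aLow aUp : ℝ} {a : ℝ → Sp n → Sp n → Matrix (Fin n) (Fin n) ℝ}
  {S : Set (Sp n)}

theorem IsDiffusionTensor.kernel_le (ha : IsDiffusionTensor T ε S aLow aUp a) {t : ℝ}
    (ht : t ∈ Icc 0 T) (u : Sp n → ℝ) {x y : Sp n} (hx : x ∈ S) (hy : y ∈ S)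
    (h : edist y x ≤ ε) :
    (u y - u x) ^ 2 / ‖y - x‖ ^ ((n : ℝ) + 2 * β x) ≤
      aLow⁻¹ * ((Dstar β ε u x y).ofLp ⬝ᵥ (a t x y *ᵥ (Dstar β ε u x y).ofLp)) := by
  rw [dotProduct_mulVec_self, ← norm_Dstar_sq u h, ← div_eq_inv_mul, le_div_iff₀ ha.aLow_pos,
    mul_comm]
  exact ha.lower t ht x hx y hy h _

/-- Beyond the horizon the left side is zero. The absolute value avoids a discussion of the sign of
`aUp`. -/
theorem IsDiffusionTensor.le_kernel (ha : IsDiffusionTensor T ε S aLow aUp a) {t : ℝ}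
    (ht : t ∈ Icc 0 T) (u : Sp n → ℝ) {x y : Sp n} (hx : x ∈ S) (hy : y ∈ S) :
    (Dstar β ε u x y).ofLp ⬝ᵥ (a t x y *ᵥ (Dstar β ε u x y).ofLp) ≤
      |aUp| * ((u y - u x) ^ 2 / ‖y - x‖ ^ ((n : ℝ) + 2 * β x)) := by
  by_cases h : edist y x ≤ ε
  · rw [dotProduct_mulVec_self, ← norm_Dstar_sq u h]
    refine (ha.upper t ht x hx y hy h _).trans ?_
    gcongr
    exact le_abs_self _
  · simp only [Dstar, alpha, if_neg h, smul_zero, WithLp.ofLp_zero, zero_dotProduct]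
    positivity

/-- Since `0 ≤ β ≤ 1`, the exponent lies between `n` and `n + 2`; enlarging the base to at least `1`
gives a constant independent of `x`. The next lemma is the counterpart for distant pairs, with base
at most `1`. -/
theorem sq_le_mul_kernel (u : Sp n → ℝ) {x y : Sp n} {R : ℝ} (h : ‖y - x‖ ≤ R)
    (h0 : 0 ≤ β x) (h1 : β x ≤ 1) :
    (u y - u x) ^ 2 ≤ max 1 R ^ ((n : ℝ) + 2) *
      ((u y - u x) ^ 2 / ‖y - x‖ ^ ((n : ℝ) + 2 * β x)) := by
  rcases eq_or_ne y x with rfl | hne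
  · simp
  have hr : 0 < ‖y - x‖ := norm_pos_iff.2 (sub_ne_zero.2 hne)
  have hp := Real.rpow_pos_of_pos hr ((n : ℝ) + 2 * β x)
  have hle : ‖y - x‖ ^ ((n : ℝ) + 2 * β x) ≤ max 1 R ^ ((n : ℝ) + 2) :=
    (Real.rpow_le_rpow hr.le (h.trans (le_max_right _ _)) (by positivity)).trans
      (Real.rpow_le_rpow_of_exponent_le (le_max_left _ _) (by linarith))
  rw [mul_div_assoc', le_div_iff₀ hp, mul_comm]
  gcongr

theorem kernel_le_mul_sq (u : Sp n → ℝ) {x y : Sp n} {R : ℝ} (hR : 0 < R) (h : R ≤ ‖y - x‖)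
    (h0 : 0 ≤ β x) (h1 : β x ≤ 1) :
    (u y - u x) ^ 2 / ‖y - x‖ ^ ((n : ℝ) + 2 * β x) ≤
      (min 1 R ^ ((n : ℝ) + 2))⁻¹ * (u y - u x) ^ 2 := by
  have hm : 0 < min 1 R := by positivity
  have hle : min 1 R ^ ((n : ℝ) + 2) ≤ ‖y - x‖ ^ ((n : ℝ) + 2 * β x) :=
    (Real.rpow_le_rpow_of_exponent_ge hm (min_le_left _ _) (by linarith)).trans
      (Real.rpow_le_rpow hm.le ((min_le_right _ _).trans h) (by positivity))
  rw [div_eq_inv_mul]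
  have := Real.rpow_pos_of_pos hm ((n : ℝ) + 2)
  gcongr

/-- The double integral of `D*(u) · (a D*(u))`, that is, twice the square of the energy norm. -/
def energyIntegral (β : Sp n → ℝ) (ε : ℝ≥0∞) (S : Set (Sp n))
    (a : ℝ → Sp n → Sp n → Matrix (Fin n) (Fin n) ℝ) (t : ℝ) (u : Sp n → ℝ) : ℝ≥0∞ :=
  ∫⁻ x in S, ∫⁻ y in S,
    ENNReal.ofReal ((Dstar β ε u x y).ofLp ⬝ᵥ (a t x y *ᵥ (Dstar β ε u x y).ofLp))

/-- The square of the seminorm of the variable-order Sobolev space. -/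
def sobolevIntegral (β : Sp n → ℝ) (S : Set (Sp n)) (u : Sp n → ℝ) : ℝ≥0∞ :=
  ∫⁻ x in S, ∫⁻ y in S,
    ENNReal.ofReal ((u y - u x) ^ 2 / ‖y - x‖ ^ ((n : ℝ) + 2 * β x))

theorem IsDiffusionTensor.energyIntegral_le (ha : IsDiffusionTensor T ε S aLow aUp a)
    (hS : MeasurableSet S) {t : ℝ} (ht : t ∈ Icc 0 T) (u : Sp n → ℝ) :
    energyIntegral β ε S a t u ≤ ENNReal.ofReal |aUp| * sobolevIntegral β S u := by
  unfold energyIntegral sobolevIntegral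
  rw [← lintegral_const_mul' _ _ ENNReal.ofReal_ne_top]
  refine setLIntegral_mono' hS fun x hx => ?_
  rw [← lintegral_const_mul' _ _ ENNReal.ofReal_ne_top]
  refine setLIntegral_mono' hS fun y hy => ?_
  rw [← ENNReal.ofReal_mul (abs_nonneg _)]
  exact ENNReal.ofReal_le_ofReal (ha.le_kernel ht u hx hy)

theorem IsDiffusionTensor.nearEnergy_le (ha : IsDiffusionTensor T ε S aLow aUp a)
    (hS : MeasurableSet S) (h0 : ∀ x ∈ S, 0 ≤ β x) (h1 : ∀ x ∈ S, β x ≤ 1) {R : ℝ}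
    (hRε : ENNReal.ofReal R ≤ ε) {t : ℝ} (ht : t ∈ Icc 0 T) (u : Sp n → ℝ) :
    nearEnergy volume S R u ≤
      ENNReal.ofReal (max 1 R ^ ((n : ℝ) + 2) * aLow⁻¹) * energyIntegral β ε S a t u := by
  unfold nearEnergy energyIntegral
  have hm : 0 ≤ max 1 R ^ ((n : ℝ) + 2) := by positivity
  have hl : 0 ≤ aLow⁻¹ := inv_nonneg.2 ha.aLow_pos.le
  rw [← lintegral_const_mul' _ _ ENNReal.ofReal_ne_top]
  refine setLIntegral_mono' hS fun x hx => ?_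
  rw [← lintegral_const_mul' _ _ ENNReal.ofReal_ne_top]
  refine le_trans (setLIntegral_mono' (hS.inter measurableSet_ball) fun y hy => ?_)
    (lintegral_mono_set inter_subset_left)
  rw [← ENNReal.ofReal_mul (mul_nonneg hm hl)]
  have hd : dist y x < R := hy.2
  have hε : edist y x ≤ ε := by
    rw [edist_dist]; exact (ENNReal.ofReal_le_ofReal hd.le).trans hRε
  refine ENNReal.ofReal_le_ofReal ((sq_le_mul_kernel u (R := R) ?_ (h0 x hx) (h1 x hx)).trans ?_)
  · rw [← dist_eq_norm]; exact hd.le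
  · rw [mul_assoc]
    exact mul_le_mul_of_nonneg_left (ha.kernel_le ht u hx hy.1 hε) hm

theorem lintegral_lintegral_sqDiff_le {X : Type*} [MeasurableSpace X] {μ : Measure X}
    [IsFiniteMeasure μ] {u : X → ℝ} (hu : Measurable u) :
    ∫⁻ x, ∫⁻ y, sqDiff u x y ∂μ ∂μ ≤ 4 * μ univ * ∫⁻ x, ENNReal.ofReal (u x ^ 2) ∂μ := by
  have hm : Measurable fun x => ENNReal.ofReal (u x ^ 2) := by fun_prop
  calc ∫⁻ x, ∫⁻ y, sqDiff u x y ∂μ ∂μ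
      ≤ ∫⁻ x, ∫⁻ y, 2 * (ENNReal.ofReal (u x ^ 2) + ENNReal.ofReal (u y ^ 2)) ∂μ ∂μ := by
        refine lintegral_mono fun x => lintegral_mono fun y => ?_
        rw [← ENNReal.ofReal_add (sq_nonneg _) (sq_nonneg _), ← ENNReal.ofReal_ofNat 2,
          ← ENNReal.ofReal_mul (by norm_num)]
        exact ENNReal.ofReal_le_ofReal (by nlinarith [sq_nonneg (u x + u y)])
    _ = 4 * μ univ * ∫⁻ x, ENNReal.ofReal (u x ^ 2) ∂μ := by
        simp_rw [lintegral_const_mul' _ _ ENNReal.ofNat_ne_top,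
          lintegral_add_left measurable_const, lintegral_const]
        rw [lintegral_add_right _ measurable_const, lintegral_const,
          lintegral_mul_const' _ _ (measure_ne_top μ univ)]
        ring

/-- Pairs within the horizon are handled by ellipticity, distant pairs by the bounded kernel and
`lintegral_lintegral_sqDiff_le`, which needs finite measure. For `ε = ∞` there are no distant pairs,
so no bound on `S` is required. -/
theorem IsDiffusionTensor.exists_sobolevIntegral_le (ha : IsDiffusionTensor T ε S aLow aUp a)
    (hS : MeasurableSet S) (hε : 0 < ε) (hSb : ε ≠ ∞ → Bornology.IsBounded S)
    (h0 : ∀ x ∈ S, 0 ≤ β x) (h1 : ∀ x ∈ S, β x ≤ 1) :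
    ∃ C : ℝ≥0, ∀ t ∈ Icc 0 T, ∀ u : Sp n → ℝ, Measurable u →
      sobolevIntegral β S u ≤
        C * (energyIntegral β ε S a t u + ∫⁻ x in S, ENNReal.ofReal (u x ^ 2)) := by
  have hl : 0 ≤ aLow⁻¹ := inv_nonneg.2 ha.aLow_pos.le
  rcases eq_or_ne ε ∞ with rfl | hε'
  · refine ⟨aLow⁻¹.toNNReal, fun t ht u _ => ?_⟩
    rw [← ENNReal.ofReal]
    refine le_trans ?_ (mul_le_mul_right le_self_add _)
    unfold sobolevIntegral energyIntegral
    rw [← lintegral_const_mul' _ _ ENNReal.ofReal_ne_top]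
    refine setLIntegral_mono' hS fun x hx => ?_
    rw [← lintegral_const_mul' _ _ ENNReal.ofReal_ne_top]
    refine setLIntegral_mono' hS fun y hy => ?_
    rw [← ENNReal.ofReal_mul hl]
    exact ENNReal.ofReal_le_ofReal (ha.kernel_le ht u hx hy le_top)
  have hR : 0 < ε.toReal := ENNReal.toReal_pos hε.ne' hε'
  have hM : 0 ≤ (min 1 ε.toReal ^ ((n : ℝ) + 2))⁻¹ := by positivity
  set M := (min 1 ε.toReal ^ ((n : ℝ) + 2))⁻¹ with hMdef
  have hfin : volume S ≠ ∞ := (hSb hε').measure_lt_top.ne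
  have : IsFiniteMeasure (volume.restrict S) := isFiniteMeasure_restrict.2 hfin
  refine ⟨aLow⁻¹.toNNReal + M.toNNReal * (4 * (volume S).toNNReal), fun t ht u hu => ?_⟩
  have hsplit : sobolevIntegral β S u ≤ ENNReal.ofReal aLow⁻¹ * energyIntegral β ε S a t u +
      ENNReal.ofReal M * ∫⁻ x in S, ∫⁻ y in S, sqDiff u x y := by
    unfold sobolevIntegral energyIntegral
    -- Additivity is used with measurability of the squared-difference term alone; none is needed
    -- for the energy density.
    rw [← lintegral_const_mul' _ _ ENNReal.ofReal_ne_top,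
      ← lintegral_const_mul' _ _ ENNReal.ofReal_ne_top, ← lintegral_add_right]
    swap
    · exact ((measurable_uncurry_sqDiff hu).lintegral_prod_right').const_mul _
    refine setLIntegral_mono' hS fun x hx => ?_
    rw [← lintegral_const_mul' _ _ ENNReal.ofReal_ne_top,
      ← lintegral_const_mul' _ _ ENNReal.ofReal_ne_top,
      ← lintegral_add_right _ ((measurable_sqDiff_right hu x).const_mul _)]
    refine setLIntegral_mono' hS fun y hy => ?_
    rw [sqDiff, ← ENNReal.ofReal_mul hl, ← ENNReal.ofReal_mul hM]
    by_cases h : edist y x ≤ ε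
    · exact (ENNReal.ofReal_le_ofReal (ha.kernel_le ht u hx hy h)).trans le_self_add
    · refine (ENNReal.ofReal_le_ofReal (kernel_le_mul_sq u hR ?_ (h0 x hx) (h1 x hx))).trans
        le_add_self
      rw [← dist_eq_norm, dist_edist]
      exact ENNReal.toReal_mono (edist_ne_top _ _) (not_le.1 h).le
  have htail := lintegral_lintegral_sqDiff_le (μ := volume.restrict S) hu
  rw [Measure.restrict_apply_univ] at htail
  refine hsplit.trans ((add_le_add_right (mul_le_mul_right htail _) _).trans ?_)
  push_cast
  rw [ENNReal.coe_toNNReal hfin, ← ENNReal.ofReal, ← ENNReal.ofReal, add_mul, mul_add, mul_add]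
  rw [← mul_assoc (ENNReal.ofReal M)]
  exact add_le_add le_self_add le_add_self

end Kernel

theorem enorm_eq_lintegral_sq {X : Type*} [MeasurableSpace X] {μ : Measure X} (u : Lp ℝ 2 μ) :
    ‖u‖ₑ = (∫⁻ x, ENNReal.ofReal (u x ^ 2) ∂μ) ^ (1 / 2 : ℝ) := by
  rw [Lp.enorm_def, eLpNorm_eq_lintegral_rpow_enorm_toReal (by norm_num) (by norm_num)]
  simp only [ENNReal.toReal_ofNat]
  congr 1
  refine lintegral_congr fun x => ?_
  rw [Real.enorm_eq_ofReal_abs, ENNReal.ofReal_rpow_of_nonneg (abs_nonneg _) (by norm_num)]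
  simp

end NonlocalDiffusion

end

/-! ### Assembly of the norm equivalence. -/

theorem theorem2p1 {n : ℕ} (hn : 1 ≤ n)
    (Ω : Set (NonlocalDiffusion.Sp n)) (hΩ : IsOpen Ω) (hΩb : Bornology.IsBounded Ω)
    (ε : ℝ≥0∞) (hε : 0 < ε)
    (β : NonlocalDiffusion.Sp n → ℝ) (βLow βUp : ℝ) (hβLow : 0 < βLow) (hβUp : βUp < 1)
    (hβc : ContinuousOn β (NonlocalDiffusion.fullDomain β ε Ω))
    (hβ : ∀ x ∈ NonlocalDiffusion.fullDomain β ε Ω, βLow ≤ β x ∧ β x ≤ βUp)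
    (T : ℝ) (hT : 0 < T) (aLow aUp : ℝ)
    (a : ℝ → NonlocalDiffusion.Sp n → NonlocalDiffusion.Sp n → Matrix (Fin n) (Fin n) ℝ)
    (ha : NonlocalDiffusion.IsDiffusionTensor T ε (NonlocalDiffusion.fullDomain β ε Ω) aLow aUp a)
    (c : NonlocalDiffusion.VolumeConstraint)
    (hc : c = NonlocalDiffusion.VolumeConstraint.neumann →
      ε ≠ ∞ ∧ NonlocalDiffusion.IsChainConnected ε (NonlocalDiffusion.fullDomain β ε Ω)) :
    (∃ C : ℝ≥0, 0 < C ∧ ∀ t ∈ Icc (0 : ℝ) T,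
      ∀ u ∈ NonlocalDiffusion.constrainedEnergySpace c β ε Ω a t,
        (C : ℝ≥0∞)⁻¹ * NonlocalDiffusion.sobolevNorm β ε Ω u
            ≤ NonlocalDiffusion.energyNorm β ε Ω a t u ∧
          NonlocalDiffusion.energyNorm β ε Ω a t u
            ≤ (C : ℝ≥0∞) * NonlocalDiffusion.sobolevNorm β ε Ω u) ∧
      ∀ t ∈ Icc (0 : ℝ) T,
        NonlocalDiffusion.constrainedSobolevSpace c β ε Ω
          = NonlocalDiffusion.constrainedEnergySpace c β ε Ω a t := by
  open NonlocalDiffusion in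
  set S := fullDomain β ε Ω with hS
  have hSo : IsOpen S := isOpen_fullDomain hΩ
  have h0 : ∀ x ∈ S, 0 ≤ β x := fun x hx => hβLow.le.trans (hβ x hx).1
  have h1 : ∀ x ∈ S, β x ≤ 1 := fun x hx => (hβ x hx).2.trans hβUp.le
  -- In the Neumann case `R` is the horizon itself, matching the chain hypothesis; in the Dirichlet
  -- case any positive real below `ε` serves, as `ε` may be infinite.
  obtain ⟨R, hRε, C₁, hC₁⟩ : ∃ R : ℝ, ENNReal.ofReal R ≤ ε ∧ ∃ C : ℝ≥0, ∀ u : L2 β ε Ω,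
      constraintFunctional c β ε Ω u = 0 →
        ∫⁻ x in S, ENNReal.ofReal (u x ^ 2) ≤ C * nearEnergy volume S R u := by
    cases c with
    | neumann =>
      obtain ⟨h, h'⟩ := hc rfl
      exact ⟨ε.toReal, ENNReal.ofReal_toReal_le, exists_lintegral_sq_le_of_neumann hΩ hΩb hε h h'⟩
    | dirichlet =>
      obtain ⟨r, hr, hrε⟩ := ENNReal.lt_iff_exists_nnreal_btwn.1 hε
      have hr' : ENNReal.ofReal r ≤ ε := by rw [ENNReal.ofReal_coe_nnreal]; exact hrε.le
      exact ⟨r, hr', exists_lintegral_sq_le_of_dirichlet hn hΩ hΩb (by simpa using hr) hr'⟩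
  obtain ⟨C₂, hC₂⟩ := ha.exists_sobolevIntegral_le hSo.measurableSet hε
    (isBounded_fullDomain hΩb) h0 h1
  set K := (max 1 R ^ ((n : ℝ) + 2) * aLow⁻¹).toNNReal with hK
  -- The two square roots bound the `L²` norm and the seminorm; the factors `2` undo the `1/2` in
  -- the energy.
  have hlow : ∀ t ∈ Icc (0 : ℝ) T, ∀ u : L2 β ε Ω, constraintFunctional c β ε Ω u = 0 →
      sobolevNorm β ε Ω u ≤ (((C₁ * K * 2) ^ (1 / 2 : ℝ) +
        (C₂ * (2 + C₁ * K * 2)) ^ (1 / 2 : ℝ) : ℝ≥0) : ℝ≥0∞) * energyNorm β ε Ω a t u := by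
    intro t ht u hu
    have hN : energyIntegral β ε S a t u = 2 * (2⁻¹ * energyIntegral β ε S a t u) := by
      rw [← mul_assoc, ENNReal.mul_inv_cancel two_ne_zero ENNReal.ofNat_ne_top, one_mul]
    have hL : ∫⁻ x in S, ENNReal.ofReal (u x ^ 2) ≤
        ((C₁ * K * 2 : ℝ≥0) : ℝ≥0∞) * (2⁻¹ * energyIntegral β ε S a t u) := by
      calc _ ≤ C₁ * nearEnergy volume S R u := hC₁ u hu
        _ ≤ C₁ * (K * energyIntegral β ε S a t u) := by
          gcongr
          exact ha.nearEnergy_le hSo.measurableSet h0 h1 hRε ht u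
        _ = _ := by
          conv_lhs => rw [hN]
          push_cast
          ring
    have hI : sobolevIntegral β S u ≤
        ((C₂ * (2 + C₁ * K * 2) : ℝ≥0) : ℝ≥0∞) * (2⁻¹ * energyIntegral β ε S a t u) := by
      calc _ ≤ C₂ * (energyIntegral β ε S a t u + ∫⁻ x in S, ENNReal.ofReal (u x ^ 2)) :=
          hC₂ t ht u (Lp.stronglyMeasurable u).measurable
        _ ≤ C₂ * (2 * (2⁻¹ * energyIntegral β ε S a t u) +
            ((C₁ * K * 2 : ℝ≥0) : ℝ≥0∞) * (2⁻¹ * energyIntegral β ε S a t u)) := by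
          rw [← hN]
          gcongr
        _ = _ := by push_cast; ring
    have hhalf : (0 : ℝ) ≤ 1 / 2 := by norm_num
    rw [sobolevNorm, enorm_eq_lintegral_sq, ENNReal.coe_add, add_mul,
      ENNReal.coe_rpow_of_nonneg _ hhalf, ENNReal.coe_rpow_of_nonneg _ hhalf, energyNorm,
      ← ENNReal.mul_rpow_of_nonneg _ _ hhalf, ← ENNReal.mul_rpow_of_nonneg _ _ hhalf]
    exact add_le_add (ENNReal.rpow_le_rpow hL hhalf) (ENNReal.rpow_le_rpow hI hhalf)
  have hup : ∀ t ∈ Icc (0 : ℝ) T, ∀ u : L2 β ε Ω, energyNorm β ε Ω a t u ≤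
      (((2⁻¹ * |aUp|.toNNReal) ^ (1 / 2 : ℝ) : ℝ≥0) : ℝ≥0∞) * sobolevNorm β ε Ω u := by
    intro t ht u
    have hhalf : (0 : ℝ) ≤ 1 / 2 := by norm_num
    refine le_trans ?_ (mul_le_mul_right (le_add_self (b := ‖u‖ₑ)) _)
    rw [ENNReal.coe_rpow_of_nonneg _ hhalf, energyNorm, sobolevSeminorm,
      ← ENNReal.mul_rpow_of_nonneg _ _ hhalf]
    refine ENNReal.rpow_le_rpow ?_ hhalf
    rw [ENNReal.coe_mul, ENNReal.coe_inv two_ne_zero, mul_assoc]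
    exact mul_le_mul_right (ha.energyIntegral_le hSo.measurableSet ht u) _
  set A : ℝ≥0 := (C₁ * K * 2) ^ (1 / 2 : ℝ) + (C₂ * (2 + C₁ * K * 2)) ^ (1 / 2 : ℝ)
  set B : ℝ≥0 := (2⁻¹ * |aUp|.toNNReal) ^ (1 / 2 : ℝ)
  -- The summand `1` makes the constant positive. Equality of the spaces follows from the same two
  -- bounds, each of which transfers finiteness.
  refine ⟨⟨A + B + 1, by positivity, fun t ht u hu => ⟨?_, ?_⟩⟩, fun t ht => ?_⟩
  · rw [ENNReal.inv_mul_le_iff (by simp) ENNReal.coe_ne_top]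
    refine (hlow t ht u hu.2).trans (mul_le_mul_left ?_ _)
    exact_mod_cast (le_self_add (a := A) (b := B)).trans le_self_add
  · refine (hup t ht u).trans (mul_le_mul_left ?_ _)
    exact_mod_cast (le_add_self (a := B) (b := A)).trans le_self_add
  · ext u
    refine and_congr_left fun hu => ⟨fun h => ?_, fun h => ?_⟩
    · exact (hup t ht u).trans_lt (ENNReal.mul_lt_top ENNReal.coe_lt_top h)
    · exact (hlow t ht u hu).trans_lt (ENNReal.mul_lt_top ENNReal.coe_lt_top h)
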